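/- Let $a<b$, $m,\sigma>0$ and $\Omega=(a,b)$. Let $H^2_*(\Omega)=H^2(\Omega)\cap H^1_0(\Omega)$ with $(u,v)_{H^2_*}=\int_\Omega u_{xx}v_{xx}\,dx$, and let $H^4_*(\Omega)=\{u\in H^4(\Omega): u\in H^2_*(\Omega),\ u_{xx}\in H^2_*(\Omega)\}$ with norm $\|u_{xxxx}\|_{L^2}$. Let $F_1:\mathbb R\to\mathbb R$ be a nondecreasing $C^1$ function with $F_1(0)=0$, let $f_2:\mathbb R\to\mathbb R$ be a $C^2$ function that is bounded below, and let $F_2=f_2'$. Let $f\in L^2(\Omega)$ (independent of time), $u_0\in H^4_*(\Omega)$ and $u_1\in H^2_*(\Omega)$. For $T>0$, a high regularity solution on $[0,T]$ of $$m u_{tt}+\sigma u_{xxxx}+F_1(u_t)+F_2(u)=f,\qquad u=u_{xx}=0\ \text{at } x=a,b,\qquad u(0)=u_0,\ u_t(0)=u_1,$$ is a function $u\in L^\infty(0,T;H^4_*(\Omega))\cap W^{1,\infty}(0,T;H^2_*(\Omega))\cap W^{2,\infty}(0,T;L^2(\Omega))$ with $u(0)=u_0$, $u'(0)=u_1$ such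 that for each $\psi\in H^2_*(\Omega)$ and almost every $t\in[0,T]$ $$m(u''(t),\psi)_{L^2}+(F_1(u'(t)),\psi)_{L^2}+\sigma(u(t),\psi)_{H^2_*}+(F_2(u(t)),\psi)_{L^2}=(f,\psi)_{L^2},$$ where $u:[0,T]\to H^2_*(\Omega)$ and $u':[0,T]\to L^2(\Omega)$ denote the continuous representatives. Put $$E_u(t)=\frac m2\|u'(t)\|_{L^2}^2+\frac\sigma2\|u(t)\|_{H^2_*}^2+\int_\Omega f_2(u(t))\,dx-(f,u(t))_{L^2}.$$ (i) There is a constant $C$, depending only on $a,b,m,\sigma,F_1,f_2,f,u_0,u_1$ (and not on $T$), such that for every $T>0$ and every high regularity solution $u$ on $[0,T]$: $E_u$ is non-increasing on $[0,T]$; $\|u(t)\|_{H^2_*}\le C$ for all $t\in[0,T]$; and $(F_1(u'),u')_{L^2}$ is integrable on $(0,T)$ with $\int_0^T(F_1(u'(s)),u'(s))_{L^2}\,ds\le C$. (ii) If $u$ is defined on $[0,\infty)$ and is a high regularity solution on $[0,T]$ for every $T>0$, then $E_u$ is non-increasing on $[0,\infty)$, there is a constant $C$ with $\|u(t)\|_{H^2_*}\le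 C$ for all $t\ge 0$, and $(F_1(u'),u')_{L^2}$ is integrable on $(0,\infty)$, that is, $\int_0^\infty(F_1(u'(s)),u'(s))_{L^2}\,ds<\infty$. -/

import Mathlib

open MeasureTheory Set
open scoped ContDiff

noncomputable section

namespace Beam

/-- The real Hilbert space `L²(a,b)`. -/
abbrev L2 (a b : ℝ) : Type := Lp ℝ 2 (volume.restrict (Ioo a b))

/-- `φ ∈ C_c^∞(a,b)`. -/
structure IsTest (a b : ℝ) (φ : ℝ → ℝ) : Prop where
  smooth : ContDiff ℝ ∞ φ
  compact : HasCompactSupport φ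
  supp : tsupport φ ⊆ Ioo a b

/-! ### Sobolev spaces on the interval `(a,b)` -/

/-- `g` is the weak derivative of `u` on `(a,b)`. -/
def IsWeakDeriv {a b : ℝ} (u g : L2 a b) : Prop :=
  ∀ φ : ℝ → ℝ, IsTest a b φ →
    ∫ x in Ioo a b, u x * deriv φ x = -∫ x in Ioo a b, g x * φ x

/-- `u ∈ H^k(a,b)`: the weak derivatives of `u` up to order `k` exist in `L²(a,b)`. -/
def MemH {a b : ℝ} : ℕ → L2 a b → Prop
  | 0, _ => True
  | k + 1, u => ∃ g, IsWeakDeriv u g ∧ MemH k g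

/-- The pairs `(φ, φ')` with `φ ∈ C_c^∞(a,b)`, as elements of `L² × L²`. -/
def testGraph (a b : ℝ) : Set (L2 a b × L2 a b) :=
  {p | ∃ φ : ℝ → ℝ, IsTest a b φ ∧ p.1 =ᵐ[volume.restrict (Ioo a b)] φ ∧
    p.2 =ᵐ[volume.restrict (Ioo a b)] deriv φ}

/-- `u ∈ H¹₀(a,b)`: `u` is in the closure of `C_c^∞(a,b)` in the norm of `H¹(a,b)`, that is, there
are test functions `φₙ` with `φₙ → u` and `φₙ' → g` in `L²` (then `g` is the weak derivative). -/
def MemH10 {a b : ℝ} (u : L2 a b) : Prop :=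
  ∃ g, (u, g) ∈ closure (testGraph a b)

open Classical in
/-- The weak derivative (zero if there is none). -/
def weakDeriv {a b : ℝ} (u : L2 a b) : L2 a b :=
  if h : ∃ g, IsWeakDeriv u g then h.choose else 0

section Basic

variable {a b : ℝ}

theorem IsTest.deriv' {φ : ℝ → ℝ} (h : IsTest a b φ) : IsTest a b (deriv φ) where
  smooth := ((contDiff_infty_iff_deriv (𝕜 := ℝ)).1 h.smooth).2
  compact := h.compact.deriv
  supp := (closure_mono (support_deriv_subset)).trans (by
    rw [isClosed_tsupport φ |>.closure_eq]; exact h.supp)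

theorem IsTest.memLp {φ : ℝ → ℝ} (h : IsTest a b φ) :
    MemLp φ 2 (volume.restrict (Ioo a b)) :=
  (h.smooth.continuous.memLp_of_hasCompactSupport h.compact).restrict _

theorem inner_eq (u g : L2 a b) : inner ℝ u g = ∫ x in Ioo a b, u x * g x := by
  rw [L2.inner_def]
  refine integral_congr_ae (Filter.Eventually.of_forall fun x => ?_)
  simp [mul_comm]

theorem inner_eq_of_ae (u g : L2 a b) {φ : ℝ → ℝ}
    (h : g =ᵐ[volume.restrict (Ioo a b)] φ) :
    inner ℝ u g = ∫ x in Ioo a b, u x * φ x := by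
  rw [inner_eq]
  refine integral_congr_ae ?_
  filter_upwards [h] with x hx
  rw [hx]

theorem isWeakDeriv_iff {u g : L2 a b} :
    IsWeakDeriv u g ↔ ∀ p ∈ testGraph a b, inner ℝ u p.2 = -inner ℝ g p.1 := by
  constructor
  · rintro h p ⟨φ, hφ, h1, h2⟩
    rw [inner_eq_of_ae u _ h2, inner_eq_of_ae g _ h1]
    exact h φ hφ
  · intro h φ hφ
    have := h (hφ.memLp.toLp φ, hφ.deriv'.memLp.toLp _)
      ⟨φ, hφ, hφ.memLp.coeFn_toLp, hφ.deriv'.memLp.coeFn_toLp⟩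
    rwa [inner_eq_of_ae u _ (MemLp.coeFn_toLp hφ.deriv'.memLp),
      inner_eq_of_ae g _ (MemLp.coeFn_toLp hφ.memLp)] at this

theorem IsWeakDeriv.add {u g u' g' : L2 a b} (h : IsWeakDeriv u g) (h' : IsWeakDeriv u' g') :
    IsWeakDeriv (u + u') (g + g') := by
  rw [isWeakDeriv_iff] at *
  intro p hp
  rw [inner_add_left, inner_add_left, h p hp, h' p hp]
  ring

theorem IsWeakDeriv.smul {u g : L2 a b} (h : IsWeakDeriv u g) (c : ℝ) :
    IsWeakDeriv (c • u) (c • g) := by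
  rw [isWeakDeriv_iff] at *
  intro p hp
  rw [real_inner_smul_left, real_inner_smul_left, h p hp]
  ring

theorem isWeakDeriv_zero : IsWeakDeriv (0 : L2 a b) 0 := by
  rw [isWeakDeriv_iff]
  simp

/-- Weak derivatives are unique. -/
theorem IsWeakDeriv.unique {u g g' : L2 a b} (h : IsWeakDeriv u g) (h' : IsWeakDeriv u g') :
    g = g' := by
  apply Lp.ext
  rw [Filter.EventuallyEq, ae_restrict_iff' measurableSet_Ioo]
  have hloc : ∀ w : L2 a b, LocallyIntegrableOn w (Ioo a b) volume := fun w =>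
    IntegrableOn.locallyIntegrableOn ((Lp.memLp w).integrable one_le_two)
  have key := isOpen_Ioo.ae_eq_zero_of_integral_contDiff_smul_eq_zero (μ := volume)
    (f := fun x => g x - g' x) ((hloc g).sub (hloc g')) (by
      intro φ hφ hc hs
      have ht : IsTest a b φ := ⟨hφ, hc, hs⟩
      have e1 := h φ ht
      rw [h' φ ht] at e1
      have i1 : Integrable (fun x => g x * φ x) (volume.restrict (Ioo a b)) :=
        (Lp.memLp g).integrable_mul ht.memLp
      have i2 : Integrable (fun x => g' x * φ x) (volume.restrict (Ioo a b)) :=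
        (Lp.memLp g').integrable_mul ht.memLp
      rw [← setIntegral_eq_integral_of_forall_compl_eq_zero (s := Ioo a b)]
      · have : ∀ x, φ x • (g x - g' x) = g x * φ x - g' x * φ x := fun x => by
          simp only [smul_eq_mul]; ring
        simp only [this]
        rw [integral_sub i1 i2]
        linarith
      · intro x hx
        rw [image_eq_zero_of_notMem_tsupport fun hx' => hx (hs hx'), zero_smul])
  filter_upwards [key] with x hx hxm
  exact sub_eq_zero.1 (hx hxm)

theorem IsWeakDeriv.weakDeriv_eq {u g : L2 a b} (h : IsWeakDeriv u g) : weakDeriv u = g := by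
  have hex : ∃ g, IsWeakDeriv u g := ⟨g, h⟩
  rw [weakDeriv, dif_pos hex]
  exact hex.choose_spec.unique h

theorem MemH.add {k : ℕ} {u v : L2 a b} (hu : MemH k u) (hv : MemH k v) : MemH k (u + v) := by
  induction k generalizing u v with
  | zero => trivial
  | succ k ih =>
    obtain ⟨g, hg, hg'⟩ := hu
    obtain ⟨h, hh, hh'⟩ := hv
    exact ⟨g + h, hg.add hh, ih hg' hh'⟩

theorem MemH.smul {k : ℕ} {u : L2 a b} (hu : MemH k u) (c : ℝ) : MemH k (c • u) := by
  induction k generalizing u with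
  | zero => trivial
  | succ k ih =>
    obtain ⟨g, hg, hg'⟩ := hu
    exact ⟨c • g, hg.smul c, ih hg'⟩

theorem memH_zero (k : ℕ) : MemH k (0 : L2 a b) := by
  induction k with
  | zero => trivial
  | succ k ih => exact ⟨0, isWeakDeriv_zero, ih⟩

theorem IsTest.add {φ ψ : ℝ → ℝ} (hφ : IsTest a b φ) (hψ : IsTest a b ψ) : IsTest a b (φ + ψ) where
  smooth := hφ.smooth.add hψ.smooth
  compact := hφ.compact.add hψ.compact
  supp := (tsupport_add φ ψ).trans (union_subset hφ.supp hψ.supp)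

theorem IsTest.const_smul {φ : ℝ → ℝ} (hφ : IsTest a b φ) (c : ℝ) : IsTest a b (c • φ) where
  smooth := hφ.smooth.const_smul c
  compact := hφ.compact.smul_left (f := fun _ => c)
  supp := (closure_mono (Function.support_const_smul_subset c φ)).trans hφ.supp

/-- The test functions, with their derivatives, form a linear subspace of `L² × L²`. -/
def testGraphSubmodule (a b : ℝ) : Submodule ℝ (L2 a b × L2 a b) where
  carrier := testGraph a b
  zero_mem' := ⟨0, ⟨contDiff_const, HasCompactSupport.zero, by simp [tsupport]⟩,
    Lp.coeFn_zero _ _ _, by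
      have : deriv (0 : ℝ → ℝ) = 0 := by ext x; simp
      rw [this]
      exact Lp.coeFn_zero _ _ _⟩
  add_mem' := by
    rintro p q ⟨φ, hφ, h1, h2⟩ ⟨ψ, hψ, k1, k2⟩
    refine ⟨φ + ψ, hφ.add hψ, (Lp.coeFn_add _ _).trans (h1.add k1), ?_⟩
    have : deriv (φ + ψ) = deriv φ + deriv ψ := by
      ext x
      exact deriv_add (hφ.smooth.differentiable (by simp) x) (hψ.smooth.differentiable (by simp) x)
    rw [this]
    exact (Lp.coeFn_add _ _).trans (h2.add k2)
  smul_mem' := by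
    rintro c p ⟨φ, hφ, h1, h2⟩
    refine ⟨c • φ, hφ.const_smul c, (Lp.coeFn_smul _ _).trans (h1.const_smul c), ?_⟩
    have : deriv (c • φ) = c • deriv φ := by
      ext x
      exact deriv_const_smul c (hφ.smooth.differentiable (by simp) x)
    rw [this]
    exact (Lp.coeFn_smul _ _).trans (h2.const_smul c)

theorem mem_closure_iff' {p : L2 a b × L2 a b} :
    p ∈ closure (testGraph a b) ↔ p ∈ (testGraphSubmodule a b).topologicalClosure := Iff.rfl

theorem isWeakDeriv_of_mem_closure {u g : L2 a b} (h : (u, g) ∈ closure (testGraph a b)) :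
    IsWeakDeriv u g := by
  rw [isWeakDeriv_iff]
  rintro q ⟨ψ, hψ, k1, k2⟩
  have hcl : IsClosed {p : L2 a b × L2 a b | inner ℝ p.1 q.2 = -inner ℝ p.2 q.1} :=
    isClosed_eq (by fun_prop) (by fun_prop)
  refine (closure_minimal (?_ : testGraph a b ⊆ _) hcl) h
  rintro p ⟨φ, hφ, h1, h2⟩
  change inner ℝ p.1 q.2 = -inner ℝ p.2 q.1
  have e1 : inner ℝ p.1 q.2 = ∫ x in Ioo a b, φ x * deriv ψ x := by
    rw [inner_eq]
    exact integral_congr_ae (h1.mul k2)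
  have e2 : inner ℝ p.2 q.1 = ∫ x in Ioo a b, deriv φ x * ψ x := by
    rw [inner_eq]
    exact integral_congr_ae (h2.mul k1)
  have z : ∀ x, x ∉ Ioo a b → φ x = 0 := fun x hx =>
    image_eq_zero_of_notMem_tsupport fun hx' => hx (hφ.supp hx')
  have z' : ∀ x, x ∉ Ioo a b → ψ x = 0 := fun x hx =>
    image_eq_zero_of_notMem_tsupport fun hx' => hx (hψ.supp hx')
  rw [e1, e2, setIntegral_eq_integral_of_forall_compl_eq_zero (fun x hx => by simp [z x hx]),
    setIntegral_eq_integral_of_forall_compl_eq_zero (fun x hx => by simp [z' x hx])]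
  have c1 := hφ.smooth.continuous
  have c2 := hψ.smooth.continuous
  have c3 := hφ.deriv'.smooth.continuous
  have c4 := hψ.deriv'.smooth.continuous
  exact integral_mul_deriv_eq_deriv_mul_of_integrable
    (fun x _ => (hφ.smooth.differentiable (by simp) x).hasDerivAt)
    (fun x _ => (hψ.smooth.differentiable (by simp) x).hasDerivAt)
    ((c1.mul c4).integrable_of_hasCompactSupport hφ.compact.mul_right)
    ((c3.mul c2).integrable_of_hasCompactSupport hψ.compact.mul_left)
    ((c1.mul c2).integrable_of_hasCompactSupport hφ.compact.mul_right)

theorem poincare_test {φ : ℝ → ℝ} (hφ : IsTest a b φ) :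
    ∫ x in Ioo a b, φ x * φ x ≤
      |∫ x in Ioo a b, φ x * (2 * (x - a) * deriv φ x)| := by
  have hd : ∀ x, HasDerivAt φ (deriv φ x) x := fun x =>
    (hφ.smooth.differentiable (by simp) x).hasDerivAt
  have z : ∀ x, x ∉ Ioo a b → φ x = 0 := fun x hx =>
    image_eq_zero_of_notMem_tsupport fun hx' => hx (hφ.supp hx')
  have c1 := hφ.smooth.continuous
  have c3 := hφ.deriv'.smooth.continuous
  rw [setIntegral_eq_integral_of_forall_compl_eq_zero (fun x hx => by simp [z x hx]),
    setIntegral_eq_integral_of_forall_compl_eq_zero (fun x hx => by simp [z x hx])]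
  have i1 : Integrable (fun x => φ x * φ x) :=
    (c1.mul c1).integrable_of_hasCompactSupport hφ.compact.mul_right
  have i2 : Integrable (fun x => φ x * (2 * (x - a) * deriv φ x)) :=
    (by fun_prop : Continuous fun x => φ x * (2 * (x - a) * deriv φ x)).integrable_of_hasCompactSupport
      hφ.compact.mul_right
  have i0 : Integrable (fun x => φ x * ((x - a) * φ x)) :=
    (by fun_prop : Continuous fun x => φ x * ((x - a) * φ x)).integrable_of_hasCompactSupport
      hφ.compact.mul_right
  have h0 := integral_eq_zero_of_hasDerivAt_of_integrable
    (f := fun x => φ x * ((x - a) * φ x))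
    (f' := fun x => φ x * φ x + φ x * (2 * (x - a) * deriv φ x))
    (fun x => by
      have := (hd x).mul (((hasDerivAt_id x).sub_const a).mul (hd x))
      refine this.congr_deriv ?_
      simp only [id, Pi.mul_apply]
      ring) (i1.add i2) i0
  rw [integral_add i1 i2] at h0
  have := neg_abs_le (∫ x, φ x * (2 * (x - a) * deriv φ x))
  have e : ∫ x, φ x * φ x = -∫ x, φ x * (2 * (x - a) * deriv φ x) := by linarith
  rw [e]
  exact neg_le_abs _

/-- The Poincaré inequality on `H¹₀(a,b)`. -/
theorem poincare {u g : L2 a b} (h : (u, g) ∈ closure (testGraph a b)) :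
    ‖u‖ ≤ 2 * |b - a| * ‖g‖ := by
  have hcl : IsClosed {p : L2 a b × L2 a b | ‖p.1‖ ≤ 2 * |b - a| * ‖p.2‖} :=
    isClosed_le (by fun_prop) (by fun_prop)
  suffices hs : testGraph a b ⊆ {p : L2 a b × L2 a b | ‖p.1‖ ≤ 2 * |b - a| * ‖p.2‖} by
    have := closure_minimal hs hcl h
    rwa [mem_ofPred_eq] at this
  rintro p ⟨φ, hφ, h1, h2⟩
  rw [mem_ofPred_eq]
  have hb : ∀ᵐ x ∂(volume.restrict (Ioo a b)),
      ‖2 * (x - a) * deriv φ x‖ ≤ 2 * |b - a| * ‖p.2 x‖ := by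
    filter_upwards [h2, ae_restrict_mem measurableSet_Ioo] with x hx hm
    rw [hx, norm_mul, norm_mul]
    gcongr
    · simp
    · rw [Real.norm_eq_abs]
      exact abs_le_abs (by linarith [hm.2]) (by linarith [hm.1, hm.2])
  have hm : MemLp (fun x => 2 * (x - a) * deriv φ x) 2 (volume.restrict (Ioo a b)) :=
    (Lp.memLp p.2).of_le_mul (by
      have := hφ.deriv'.smooth.continuous
      exact (by fun_prop : Continuous fun x => 2 * (x - a) * deriv φ x).aestronglyMeasurable) hb
  have hn : ‖hm.toLp‖ ≤ 2 * |b - a| * ‖p.2‖ := by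
    refine Lp.norm_le_mul_norm_of_ae_le_mul ?_
    filter_upwards [hb, hm.coeFn_toLp] with x hx hx'
    rw [hx']
    exact hx
  have e1 : ‖p.1‖ * ‖p.1‖ = ∫ x in Ioo a b, φ x * φ x := by
    rw [← real_inner_self_eq_norm_mul_norm, inner_eq]
    exact integral_congr_ae (h1.mul h1)
  have e2 : inner ℝ p.1 hm.toLp = ∫ x in Ioo a b, φ x * (2 * (x - a) * deriv φ x) := by
    rw [inner_eq]
    exact integral_congr_ae (h1.mul hm.coeFn_toLp)
  have e3 : ‖p.1‖ * ‖p.1‖ ≤ ‖p.1‖ * (2 * |b - a| * ‖p.2‖) := by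
    calc ‖p.1‖ * ‖p.1‖ ≤ |inner ℝ p.1 hm.toLp| := by rw [e1, e2]; exact poincare_test hφ
      _ ≤ ‖p.1‖ * ‖hm.toLp‖ := abs_real_inner_le_norm _ _
      _ ≤ _ := by gcongr
  rcases (norm_nonneg p.1).eq_or_lt with h0 | h0
  · rw [← h0]; positivity
  · exact le_of_mul_le_mul_left e3 h0

/-- If `u ∈ H¹₀` and `u'` has the weak derivative `h`, then `‖u'‖ ≤ 2 |b - a| ‖h‖`. -/
theorem poincare₂ {u g h : L2 a b} (hu : (u, g) ∈ closure (testGraph a b))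
    (hg : IsWeakDeriv g h) : ‖g‖ ≤ 2 * |b - a| * ‖h‖ := by
  have e : inner ℝ g g = -inner ℝ h u := by
    have hcl : IsClosed {p : L2 a b × L2 a b | inner ℝ g p.2 = -inner ℝ h p.1} :=
      isClosed_eq (by fun_prop) (by fun_prop)
    exact (closure_minimal (isWeakDeriv_iff.1 hg) hcl) hu
  have e3 : ‖g‖ * ‖g‖ ≤ ‖g‖ * (2 * |b - a| * ‖h‖) := by
    calc ‖g‖ * ‖g‖ = -inner ℝ h u := by rw [← real_inner_self_eq_norm_mul_norm, e]
      _ ≤ |inner ℝ h u| := neg_le_abs _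
      _ ≤ ‖h‖ * ‖u‖ := abs_real_inner_le_norm _ _
      _ ≤ ‖h‖ * (2 * |b - a| * ‖g‖) := by gcongr; exact poincare hu
      _ = _ := by ring
  rcases (norm_nonneg g).eq_or_lt with h0 | h0
  · rw [← h0]; positivity
  · exact le_of_mul_le_mul_left e3 h0

end Basic

/-! ### The Hilbert space `H²_*(a,b) = H²(a,b) ∩ H¹₀(a,b)` -/

/-- `H²(a,b) ∩ H¹₀(a,b)`, as a linear subspace of `L²(a,b)`. -/
def H2StarSubmodule (a b : ℝ) : Submodule ℝ (L2 a b) where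
  carrier := {u | MemH 2 u ∧ MemH10 u}
  zero_mem' := ⟨memH_zero 2, 0, (testGraphSubmodule a b).topologicalClosure.zero_mem⟩
  add_mem' := by
    rintro u v ⟨hu, g, hg⟩ ⟨hv, h, hh⟩
    exact ⟨hu.add hv, g + h, (testGraphSubmodule a b).topologicalClosure.add_mem hg hh⟩
  smul_mem' := by
    rintro c u ⟨hu, g, hg⟩
    exact ⟨hu.smul c, c • g, (testGraphSubmodule a b).topologicalClosure.smul_mem c hg⟩

/-- The space `H²_*(a,b)`, to be normed by `‖u_xx‖_{L²}` (and not by the norm of `L²`). -/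
def H2Star (a b : ℝ) : Type := H2StarSubmodule a b

instance (a b : ℝ) : AddCommGroup (H2Star a b) :=
  inferInstanceAs (AddCommGroup (H2StarSubmodule a b))

instance (a b : ℝ) : Module ℝ (H2Star a b) :=
  inferInstanceAs (Module ℝ (H2StarSubmodule a b))

namespace H2Star

variable {a b : ℝ}

/-- The inclusion `H²_*(a,b) ⊆ L²(a,b)`. -/
def toL2 : H2Star a b →ₗ[ℝ] L2 a b := (H2StarSubmodule a b).subtype

theorem toL2_injective : Function.Injective (toL2 : H2Star a b → L2 a b) :=
  Subtype.val_injective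

theorem exists_deriv (u : H2Star a b) : ∃ g h, (toL2 u, g) ∈ closure (testGraph a b) ∧
    IsWeakDeriv (toL2 u) g ∧ IsWeakDeriv g h := by
  obtain ⟨⟨g, hg, h, hh, -⟩, k, hk⟩ := u.2
  obtain rfl := hg.unique (isWeakDeriv_of_mem_closure hk)
  exact ⟨g, h, hk, hg, hh⟩

/-- The second weak derivative `u ↦ u_xx`, as a linear map `H²_*(a,b) → L²(a,b)`. -/
def dxx : H2Star a b →ₗ[ℝ] L2 a b where
  toFun u := weakDeriv (weakDeriv (toL2 u))
  map_add' u v := by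
    obtain ⟨g, h, -, hg, hh⟩ := u.exists_deriv
    obtain ⟨g', h', -, hg', hh'⟩ := v.exists_deriv
    rw [map_add, (hg.add hg').weakDeriv_eq, (hh.add hh').weakDeriv_eq, hg.weakDeriv_eq,
      hh.weakDeriv_eq, hg'.weakDeriv_eq, hh'.weakDeriv_eq]
  map_smul' c u := by
    obtain ⟨g, h, -, hg, hh⟩ := u.exists_deriv
    rw [map_smul, (hg.smul c).weakDeriv_eq, (hh.smul c).weakDeriv_eq, hg.weakDeriv_eq,
      hh.weakDeriv_eq, RingHom.id_apply]

theorem exists_spec (u : H2Star a b) : ∃ g, (toL2 u, g) ∈ closure (testGraph a b) ∧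
    IsWeakDeriv (toL2 u) g ∧ IsWeakDeriv g (dxx u) := by
  obtain ⟨g, h, hc, hg, hh⟩ := u.exists_deriv
  refine ⟨g, hc, hg, ?_⟩
  have : dxx u = h := by
    change weakDeriv (weakDeriv (toL2 u)) = h
    rw [hg.weakDeriv_eq, hh.weakDeriv_eq]
  rwa [this]

theorem norm_toL2_le (u : H2Star a b) :
    ‖toL2 u‖ ≤ 2 * |b - a| * (2 * |b - a| * ‖dxx u‖) := by
  obtain ⟨g, hc, -, hh⟩ := u.exists_spec
  exact (poincare hc).trans (by gcongr; exact poincare₂ hc hh)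

theorem dxx_injective : Function.Injective (dxx : H2Star a b → L2 a b) := by
  rw [injective_iff_map_eq_zero]
  intro u hu
  have := norm_toL2_le u
  rw [hu, norm_zero, mul_zero, mul_zero] at this
  exact toL2_injective (by rw [norm_le_zero_iff.1 this, map_zero])

/-- The norm `‖u‖_{H²_*} = ‖u_xx‖_{L²}`. -/
instance : NormedAddCommGroup (H2Star a b) :=
  NormedAddCommGroup.induced (H2Star a b) (L2 a b) dxx dxx_injective

theorem norm_eq (u : H2Star a b) : ‖u‖ = ‖dxx u‖ := rfl

/-- The inner product `(u,v)_{H²_*} = ∫ u_xx v_xx dx`. -/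
instance : InnerProductSpace ℝ (H2Star a b) where
  norm_smul_le c u := by rw [norm_eq, norm_eq, map_smul, norm_smul]
  inner u v := ∫ x in Ioo a b, dxx u x * dxx v x
  norm_sq_eq_re_inner u := by
    rw [← inner_eq, norm_eq]
    exact norm_sq_eq_re_inner (𝕜 := ℝ) (dxx u)
  conj_inner_symm u v := by
    simp only [mul_comm, conj_trivial]
  add_left u v w := by
    simp only [← inner_eq, map_add, inner_add_left]
  smul_left u v c := by
    simp only [← inner_eq, map_smul, inner_smul_left]

/-- `H²_*(a,b)` is a Hilbert space. -/
instance : CompleteSpace (H2Star a b) := by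
  refine Metric.complete_of_cauchySeq_tendsto fun u hu => ?_
  choose g hc hg hh using fun n => (u n).exists_spec
  have hsub : ∀ n k, ((toL2 (u n) - toL2 (u k), g n - g k) ∈ closure (testGraph a b)) :=
    fun n k => (testGraphSubmodule a b).topologicalClosure.sub_mem (hc n) (hc k)
  have hsub' : ∀ n k, IsWeakDeriv (g n - g k) (dxx (u n - u k)) := fun n k => by
    rw [map_sub, sub_eq_add_neg, sub_eq_add_neg, ← neg_one_smul ℝ (g k),
      ← neg_one_smul ℝ (dxx (u k))]
    exact (hh n).add ((hh k).smul _)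
  have cg : CauchySeq g := by
    rw [Metric.cauchySeq_iff] at *
    intro ε hε
    obtain ⟨N, hN⟩ := hu (ε / (2 * |b - a| + 1)) (by positivity)
    refine ⟨N, fun n hn k hk => ?_⟩
    have h1 := hN n hn k hk
    rw [dist_eq_norm, lt_div_iff₀ (by positivity), norm_eq] at h1
    rw [dist_eq_norm]
    have h2 := poincare₂ (hsub n k) (hsub' n k)
    nlinarith [norm_nonneg (dxx (u n - u k))]
  have cu : CauchySeq fun n => toL2 (u n) := by
    rw [Metric.cauchySeq_iff] at cg ⊢
    intro ε hε
    obtain ⟨N, hN⟩ := cg (ε / (2 * |b - a| + 1)) (by positivity)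
    refine ⟨N, fun n hn k hk => ?_⟩
    have h1 := hN n hn k hk
    rw [dist_eq_norm, lt_div_iff₀ (by positivity)] at h1
    rw [dist_eq_norm]
    have h2 := poincare (hsub n k)
    nlinarith [norm_nonneg (g n - g k)]
  have cd : CauchySeq fun n => dxx (u n) := by
    rw [Metric.cauchySeq_iff] at hu ⊢
    intro ε hε
    obtain ⟨N, hN⟩ := hu ε hε
    refine ⟨N, fun n hn k hk => ?_⟩
    have h1 := hN n hn k hk
    rwa [dist_eq_norm, norm_eq, map_sub, ← dist_eq_norm] at h1
  obtain ⟨G, hG⟩ := cauchySeq_tendsto_of_complete cg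
  obtain ⟨U, hU⟩ := cauchySeq_tendsto_of_complete cu
  obtain ⟨D, hD⟩ := cauchySeq_tendsto_of_complete cd
  have hUG : (U, G) ∈ closure (testGraph a b) :=
    isClosed_closure.mem_of_tendsto (hU.prodMk_nhds hG) (Filter.Eventually.of_forall hc)
  have hGD : IsWeakDeriv G D := by
    rw [isWeakDeriv_iff]
    intro p hp
    refine tendsto_nhds_unique (hG.inner (tendsto_const_nhds (x := p.2))) ?_
    have := (hD.inner (𝕜 := ℝ) (tendsto_const_nhds (x := p.1))).neg
    refine this.congr fun n => ?_
    exact (isWeakDeriv_iff.1 (hh n) p hp).symm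
  have hUG' := isWeakDeriv_of_mem_closure hUG
  let W : H2Star a b := ⟨U, ⟨G, hUG', D, hGD, trivial⟩, G, hUG⟩
  have hW : dxx W = D := by
    change weakDeriv (weakDeriv U) = D
    rw [hUG'.weakDeriv_eq, hGD.weakDeriv_eq]
  refine ⟨W, ?_⟩
  rw [tendsto_iff_norm_sub_tendsto_zero] at hD ⊢
  refine hD.congr fun n => ?_
  rw [norm_eq, map_sub, hW]

end H2Star

/-! ### The space `H⁴_*(a,b)` -/

/-- The `u ∈ H⁴(a,b)` with `u ∈ H²_*(a,b)` and `u_xx ∈ H²_*(a,b)`, as a subspace of `H²_*(a,b)`. -/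
def H4StarSubmodule (a b : ℝ) : Submodule ℝ (H2Star a b) where
  carrier := {u | MemH 4 (H2Star.toL2 u) ∧ H2Star.dxx u ∈ H2StarSubmodule a b}
  zero_mem' := ⟨by rw [map_zero]; exact memH_zero 4, by rw [map_zero]; exact Submodule.zero_mem _⟩
  add_mem' := by
    rintro u v ⟨hu, hu'⟩ ⟨hv, hv'⟩
    exact ⟨by rw [map_add]; exact hu.add hv, by rw [map_add]; exact Submodule.add_mem _ hu' hv'⟩
  smul_mem' := by
    rintro c u ⟨hu, hu'⟩
    exact ⟨by rw [map_smul]; exact hu.smul c, by rw [map_smul]; exact Submodule.smul_mem _ c hu'⟩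

/-- The space `H⁴_*(a,b)`, to be normed by `‖u_xxxx‖_{L²}`. -/
def H4Star (a b : ℝ) : Type := H4StarSubmodule a b

instance (a b : ℝ) : AddCommGroup (H4Star a b) :=
  inferInstanceAs (AddCommGroup (H4StarSubmodule a b))

instance (a b : ℝ) : Module ℝ (H4Star a b) :=
  inferInstanceAs (Module ℝ (H4StarSubmodule a b))

namespace H4Star

variable {a b : ℝ}

/-- The inclusion `H⁴_*(a,b) ⊆ H²_*(a,b)`. -/
def toH2 : H4Star a b →ₗ[ℝ] H2Star a b := (H4StarSubmodule a b).subtype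

/-- The second derivative as a linear map `H⁴_*(a,b) → H²_*(a,b)`. -/
def dxx : H4Star a b →ₗ[ℝ] H2Star a b where
  toFun u := ⟨H2Star.dxx (toH2 u), u.2.2⟩
  map_add' u v := Subtype.ext (by
    change H2Star.dxx (toH2 (u + v)) = H2Star.dxx (toH2 u) + H2Star.dxx (toH2 v)
    rw [map_add, map_add])
  map_smul' c u := Subtype.ext (by
    change H2Star.dxx (toH2 (c • u)) = c • H2Star.dxx (toH2 u)
    rw [map_smul, map_smul])

/-- The fourth derivative `u ↦ u_xxxx` as a linear map `H⁴_*(a,b) → L²(a,b)`. -/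
def dxxxx : H4Star a b →ₗ[ℝ] L2 a b := H2Star.dxx ∘ₗ dxx

theorem dxxxx_injective : Function.Injective (dxxxx : H4Star a b → L2 a b) := by
  refine H2Star.dxx_injective.comp fun u v h => ?_
  exact Subtype.val_injective (H2Star.dxx_injective (congrArg H2Star.toL2 h))

/-- The norm `‖u‖_{H⁴_*} = ‖u_xxxx‖_{L²}`. -/
instance : NormedAddCommGroup (H4Star a b) :=
  NormedAddCommGroup.induced (H4Star a b) (L2 a b) dxxxx dxxxx_injective

end H4Star

/-! ### Functions of time with values in a Banach space -/

/-- `u ∈ L^∞(0,T;X)`. -/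
def MemLinfty {X : Type*} [NormedAddCommGroup X] (T : ℝ) (u : ℝ → X) : Prop :=
  MemLp u ⊤ (volume.restrict (Ioo 0 T))

/-- `u ∈ W^{1,∞}(0,T;X)` with the weak time derivative `u' = v`: both functions are in
`L^∞(0,T;X)`, and `∫ φ'(t) u(t) dt = -∫ φ(t) v(t) dt` in `X` for all `φ ∈ C_c^∞(0,T)`. -/
structure MemW1infty {X : Type*} [NormedAddCommGroup X] [NormedSpace ℝ X] (T : ℝ)
    (u v : ℝ → X) : Prop where
  mem : MemLinfty T u
  mem_deriv : MemLinfty T v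
  weak_deriv : ∀ φ : ℝ → ℝ, IsTest 0 T φ →
    ∫ t in Ioo 0 T, deriv φ t • u t = -∫ t in Ioo 0 T, φ t • v t

/-! ### The beam equation -/

/-- `u` is a high regularity solution on `[0,T]`, with time derivative `v = u'`, of
`m u_tt + σ u_xxxx + F₁(u_t) + F₂(u) = f` on `(a,b) × (0,T]`,
`u = u_xx = 0` at `x = a` and at `x = b`, `u(0) = u₀`, `u_t(0) = u₁`.

A function in `W^{1,∞}(0,T;X)` is identified with its continuous representative, so `u` is
continuous into `H²_*` and `u'` is continuous into `L²`; this gives a sense to the initial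
conditions and to the values of `u` and `u'` at each time. -/
structure IsHighRegularitySolution {a b : ℝ} (m σ : ℝ) (F₁ F₂ : ℝ → ℝ) (f : ℝ → L2 a b)
    (u₀ : H4Star a b) (u₁ : H2Star a b) (T : ℝ) (u : ℝ → H2Star a b) (v : ℝ → L2 a b) :
    Prop where
  continuousOn : ContinuousOn u (Icc 0 T)
  continuousOn_deriv : ContinuousOn v (Icc 0 T)
  init : u 0 = H4Star.toH2 u₀
  init_deriv : v 0 = H2Star.toL2 u₁
  /-- `u ∈ L^∞(0,T;H⁴_*)` -/
  mem_H4 : ∃ U : ℝ → H4Star a b, MemLinfty T U ∧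
    ∀ᵐ t ∂(volume.restrict (Ioo 0 T)), u t = H4Star.toH2 (U t)
  /-- `u ∈ W^{1,∞}(0,T;H²_*)` -/
  mem_H2 : ∃ V : ℝ → H2Star a b, MemW1infty T u V ∧
    ∀ᵐ t ∂(volume.restrict (Ioo 0 T)), v t = H2Star.toL2 (V t)
  /-- `u ∈ W^{2,∞}(0,T;L²)`, with `w = u''`, and the weak form of the equation -/
  mem_L2 : MemW1infty T (fun t => H2Star.toL2 (u t)) v ∧
    ∃ w : ℝ → L2 a b, MemW1infty T v w ∧
      ∀ ψ : H2Star a b, ∀ᵐ t ∂(volume.restrict (Ioo 0 T)),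
        m * inner ℝ (w t) (H2Star.toL2 ψ)
          + (∫ x in Ioo a b, F₁ (v t x) * H2Star.toL2 ψ x)
          + σ * inner ℝ (u t) ψ
          + (∫ x in Ioo a b, F₂ (H2Star.toL2 (u t) x) * H2Star.toL2 ψ x)
        = inner ℝ (f t) (H2Star.toL2 ψ)

/-- The total energy
`E_u(t) = (m/2) ‖u'(t)‖²_{L²} + (σ/2) ‖u(t)‖²_{H²_*} + ∫ f₂(u(t)) dx - (f, u(t))_{L²}`. -/
def energy {a b : ℝ} (m σ : ℝ) (f₂ : ℝ → ℝ) (f : L2 a b) (u : ℝ → H2Star a b)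
    (v : ℝ → L2 a b) (t : ℝ) : ℝ :=
  m / 2 * ‖v t‖ ^ 2 + σ / 2 * ‖u t‖ ^ 2
    + (∫ x in Ioo a b, f₂ (H2Star.toL2 (u t) x)) - inner ℝ f (H2Star.toL2 (u t))

/-- The rate of dissipation `(F₁(u'(t)), u'(t))_{L²}`. -/
def dissipation {a b : ℝ} (F₁ : ℝ → ℝ) (v : ℝ → L2 a b) (t : ℝ) : ℝ :=
  ∫ x in Ioo a b, F₁ (v t x) * v t x

end Beam

end

/-!
The proof is the energy identity `E_u' = -(F₁(u'), u')` for almost every time, made rigorous for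
solutions which have only weak time derivatives.

* A function in `W^{1,∞}(0,T;X)` is the primitive of its weak derivative
  (`MemW1infty.eq_integral`, from the du Bois-Reymond lemma). By Lebesgue's differentiation theorem
  it is therefore Lipschitz, and differentiable almost everywhere with the weak derivative as its
  derivative. This applies to `u` in `H²_*` and to `u'` in `L²`.
* Since `H²_*` embeds in `L^∞` (`H2Star.ae_abs_le`), the potential energy `u ↦ ∫ f₂(u)` is Fréchet
  differentiable on `H²_*` (`H2Star.hasFDerivAt_potential`) and Lipschitz on balls. Hence `E_u` is
  absolutely continuous and the chain rule gives its derivative almost everywhere.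
* As `H²_*` is separable, for almost every `t` the weak form of the equation holds with all test
  functions at once (`IsHighRegularitySolution.exists_ae_forall_eq`), in particular with
  `u'(t) ∈ H²_*`. This identifies the derivative of `E_u` as `-(F₁(u'), u')`, which is not positive
  because `F₁` is nondecreasing and vanishes at zero.

The fundamental theorem of calculus then shows that `E_u` is non-increasing and that the total
dissipation is the energy lost. The energy is bounded below by `(σ/4) ‖u‖²_{H²_*} - C`
(`exists_le_energy`), and at time zero it depends on the data only, so all bounds are independent of
the length of the time interval.
-/

noncomputable section

namespace Beam

/-! ### Functions of time with a weak derivative in `L^∞` -/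

/-- A test function of mean zero is the derivative of a test function. -/
theorem IsTest.exists_primitive {a b : ℝ} {φ : ℝ → ℝ} (hφ : IsTest a b φ)
    (h0 : ∫ x, φ x = 0) : ∃ ψ, IsTest a b ψ ∧ deriv ψ = φ := by
  have hc := hφ.smooth.continuous
  obtain ⟨α, β, hαa, hβb, hK⟩ : ∃ α β, a < α ∧ β < b ∧ tsupport φ ⊆ Icc α β := by
    rcases (tsupport φ).eq_empty_or_nonempty with he | hne
    · exact ⟨a + 1, b - 1, by linarith, by linarith, by simp [he]⟩
    · obtain ⟨α, hα⟩ := hφ.compact.isCompact.exists_isLeast hne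
      obtain ⟨β, hβ⟩ := hφ.compact.isCompact.exists_isGreatest hne
      exact ⟨α, β, (hφ.supp hα.1).1, (hφ.supp hβ.1).2, fun x hx => ⟨hα.2 hx, hβ.2 hx⟩⟩
  have hz : ∀ x, x ∉ Icc α β → φ x = 0 := fun x hx =>
    image_eq_zero_of_notMem_tsupport fun hx' => hx (hK hx')
  have hd : deriv (fun x => ∫ t in a..x, φ t) = φ := by
    ext x
    exact hc.deriv_integral φ a x
  have hsupp : tsupport (fun x => ∫ t in a..x, φ t) ⊆ Icc α β := by
    refine closure_minimal (fun x hx => ?_) isClosed_Icc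
    by_contra hn
    refine hx ?_
    rcases lt_or_ge x α with h | h
    · refine intervalIntegral.integral_zero_ae (Filter.Eventually.of_forall fun t ht => hz t ?_)
      intro ht'
      exact absurd ht'.1 (not_le.2 (ht.2.trans_lt (max_lt hαa h)))
    · have hβx : β < x := by
        by_contra hle
        exact hn ⟨h, not_lt.1 hle⟩
      change ∫ t in a..x, φ t = 0
      rw [intervalIntegral.integral_eq_integral_of_support_subset, h0]
      intro t ht
      have : t ∈ Icc α β := by
        by_contra h'
        exact ht (hz t h')
      exact ⟨hαa.trans_le this.1, this.2.trans hβx.le⟩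
  refine ⟨_, ⟨?_, ?_, hsupp.trans fun x hx => ⟨hαa.trans_le hx.1, hx.2.trans_lt hβb⟩⟩, hd⟩
  · rw [contDiff_infty_iff_deriv, hd]
    exact ⟨fun x => (hc.integral_hasStrictDerivAt a x).hasDerivAt.differentiableAt, hφ.smooth⟩
  · exact HasCompactSupport.of_support_subset_isCompact isCompact_Icc
      ((subset_tsupport _).trans hsupp)

/-- There is a test function of integral one on every nonempty interval. -/
theorem exists_isTest_integral_eq_one {a b : ℝ} (hab : a < b) :
    ∃ φ, IsTest a b φ ∧ ∫ x, φ x = 1 := by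
  let B : ContDiffBump ((a + b) / 2) := ⟨(b - a) / 8, (b - a) / 4, by linarith, by linarith⟩
  refine ⟨B.normed volume, ⟨B.contDiff_normed, B.hasCompactSupport_normed, ?_⟩, B.integral_normed⟩
  rw [B.tsupport_normed_eq, Real.closedBall_eq_Icc]
  intro x hx
  have h1 : (a + b) / 2 - (b - a) / 4 ≤ x := hx.1
  have h2 : x ≤ (a + b) / 2 + (b - a) / 4 := hx.2
  exact ⟨by linarith, by linarith⟩

variable {X : Type*} [NormedAddCommGroup X] {T : ℝ}

theorem MemLinfty.exists_bound {V : ℝ → X} (hV : MemLinfty T V) :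
    ∃ K : NNReal, ∀ᵐ t, t ∈ Ioo 0 T → ‖V t‖ ≤ K := by
  refine ⟨(eLpNorm V ⊤ (volume.restrict (Ioo 0 T))).toNNReal, ?_⟩
  rw [← ae_restrict_iff' measurableSet_Ioo]
  filter_upwards [ae_le_eLpNormEssSup (f := V) (μ := volume.restrict (Ioo 0 T))] with t ht
  rw [← eLpNorm_exponent_top] at ht
  have h1 := ENNReal.toReal_mono hV.2.ne ht
  rwa [toReal_enorm] at h1

theorem MemLinfty.intervalIntegrable {V : ℝ → X} (hV : MemLinfty T V) (hT : 0 ≤ T) :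
    IntervalIntegrable V volume 0 T := by
  rw [intervalIntegrable_iff_integrableOn_Ioo_of_le hT]
  exact hV.integrable le_top

variable [NormedSpace ℝ X]

/-- The primitive of an essentially bounded function is Lipschitz. -/
theorem lipschitzOnWith_primitive (hT : 0 ≤ T) {V : ℝ → X} {K : NNReal}
    (hi : IntervalIntegrable V volume 0 T) (hV : ∀ᵐ t, t ∈ Ioo 0 T → ‖V t‖ ≤ K) :
    LipschitzOnWith K (fun t => ∫ s in (0 : ℝ)..t, V s) (Icc 0 T) := by
  have hT' : ∀ᵐ t : ℝ, t ≠ T := by simp [ae_iff]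
  refine LipschitzOnWith.of_dist_le_mul fun t ht s hs => ?_
  have sub : ∀ r ∈ Icc 0 T, IntervalIntegrable V volume 0 r := fun r hr =>
    hi.mono_set (by rw [uIcc_of_le hr.1, uIcc_of_le hT]; exact Icc_subset_Icc_right hr.2)
  rw [dist_eq_norm, intervalIntegral.integral_interval_sub_left (sub t ht) (sub s hs),
    Real.dist_eq]
  refine intervalIntegral.norm_integral_le_of_norm_le_const_ae ?_
  filter_upwards [hV, hT'] with r hr hrT hr'
  exact hr ⟨(le_min hs.1 ht.1).trans_lt hr'.1, lt_of_le_of_ne (hr'.2.trans (max_le hs.2 ht.2)) hrT⟩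

variable [CompleteSpace X]

/-- The du Bois-Reymond lemma: a continuous function whose weak derivative vanishes is constant. -/
theorem exists_eq_const_of_integral_deriv_smul_eq_zero {a b : ℝ} (hab : a < b) {z : ℝ → X}
    (hz : ContinuousOn z (Icc a b))
    (h : ∀ φ, IsTest a b φ → ∫ t in Ioo a b, deriv φ t • z t = 0) :
    ∃ C, ∀ t ∈ Icc a b, z t = C := by
  obtain ⟨φ₀, hφ₀, hφ₀1⟩ := exists_isTest_integral_eq_one hab
  have hint : ∀ g, IsTest a b g → ∀ w : ℝ → X, ContinuousOn w (Icc a b) →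
      IntegrableOn (fun t => g t • w t) (Ioo a b) := fun g hg w hw =>
    ((hg.smooth.continuous.continuousOn.smul hw).integrableOn_Icc).mono_set Ioo_subset_Icc_self
  have hI : ∀ g, IsTest a b g → Integrable g := fun g hg =>
    hg.smooth.continuous.integrable_of_hasCompactSupport hg.compact
  set C := ∫ t in Ioo a b, φ₀ t • z t with hC
  have key : ∀ g, IsTest a b g → ∫ t in Ioo a b, g t • z t = (∫ t, g t) • C := by
    intro g hg
    -- `g - (∫ g) φ₀` has mean zero, so it is the derivative of a test function
    have ht : IsTest a b (g + (-∫ t, g t) • φ₀) := hg.add (hφ₀.const_smul _)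
    obtain ⟨ψ, hψ, hψd⟩ := ht.exists_primitive (by
      have := integral_add (hI g hg) ((hI φ₀ hφ₀).const_mul (-∫ t, g t))
      simp only [Pi.add_apply, Pi.smul_apply, smul_eq_mul]
      rw [this, integral_const_mul, hφ₀1]
      ring)
    have h1 := h ψ hψ
    rw [hψd] at h1
    have h2 := integral_add (hint g hg z hz) ((hint φ₀ hφ₀ z hz).smul (-∫ t, g t))
    simp only [Pi.add_apply, Pi.smul_apply, add_smul, smul_assoc] at h1 h2
    rw [h2, integral_smul, ← hC, neg_smul] at h1
    exact eq_of_sub_eq_zero (by rwa [sub_eq_add_neg])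
  have hae := isOpen_Ioo.ae_eq_zero_of_integral_contDiff_smul_eq_zero (μ := volume)
    (f := fun t => z t - C) (U := Ioo a b)
    (((hz.sub continuousOn_const).integrableOn_Icc.mono_set Ioo_subset_Icc_self
      ).locallyIntegrableOn) (by
      intro g hg hgc hgs
      have ht : IsTest a b g := ⟨hg, hgc, hgs⟩
      have z0 : ∀ x, x ∉ Ioo a b → g x = 0 := fun x hx =>
        image_eq_zero_of_notMem_tsupport fun hx' => hx (hgs hx')
      rw [← setIntegral_eq_integral_of_forall_compl_eq_zero (s := Ioo a b)
        (fun x hx => by simp [z0 x hx])]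
      simp only [smul_sub]
      rw [integral_sub (hint g ht z hz) (hint g ht _ continuousOn_const), key g ht,
        integral_smul_const, setIntegral_eq_integral_of_forall_compl_eq_zero z0, sub_self])
  refine ⟨C, Measure.eqOn_Icc_of_ae_eq (μ := volume) hab.ne ?_ hz continuousOn_const⟩
  rw [← restrict_Ioo_eq_restrict_Icc, Filter.EventuallyEq, ae_restrict_iff' measurableSet_Ioo]
  filter_upwards [hae] with x hx hm
  exact sub_eq_zero.1 (hx hm)

/-- Integration by parts for a test function and the primitive of an essentially bounded
function. -/
theorem integral_deriv_smul_primitive (hT : 0 < T) {V : ℝ → X} (hV : MemLinfty T V)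
    {φ : ℝ → ℝ} (hφ : IsTest 0 T φ) :
    ∫ t in Ioo 0 T, deriv φ t • ∫ s in (0 : ℝ)..t, V s = -∫ t in Ioo 0 T, φ t • V t := by
  obtain ⟨K, hK⟩ := hV.exists_bound
  have hi := hV.intervalIntegrable hT.le
  have hU := lipschitzOnWith_primitive hT.le hi hK
  set U : ℝ → X := fun t => ∫ s in (0 : ℝ)..t, V s with hUdef
  have hφc := hφ.smooth.continuous
  have hφc' := hφ.deriv'.smooth.continuous
  have i1 : IntervalIntegrable (fun t => deriv φ t • U t) volume 0 T := by
    refine ContinuousOn.intervalIntegrable ?_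
    rw [uIcc_of_le hT.le]
    exact hφc'.continuousOn.smul hU.continuousOn
  have i2 : IntervalIntegrable (fun t => φ t • V t) volume 0 T :=
    hi.continuousOn_smul hφc.continuousOn
  obtain ⟨M, hM⟩ := isCompact_Icc.exists_bound_of_continuousOn
    (hφc'.continuousOn.smul hU.continuousOn : ContinuousOn (fun t => deriv φ t • U t) (Icc 0 T))
  obtain ⟨N, hN⟩ := isCompact_Icc.exists_bound_of_continuousOn
    (hφc.continuousOn : ContinuousOn φ (Icc 0 T))
  have hJ := lipschitzOnWith_primitive hT.le (K := (M + N * K).toNNReal) (i1.add i2) (by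
    filter_upwards [hK] with t ht htm
    refine le_trans ?_ (Real.le_coe_toNNReal _)
    refine (norm_add_le _ _).trans (add_le_add (hM t (Ioo_subset_Icc_self htm)) ?_)
    rw [norm_smul]
    exact mul_le_mul (hN t (Ioo_subset_Icc_self htm)) (ht htm) (norm_nonneg _)
      ((norm_nonneg _).trans (hN t (Ioo_subset_Icc_self htm))))
  rw [← uIcc_of_le hT.le] at hU hJ
  have hac := ((hφ.smooth.of_le (by simp)).contDiffOn.absolutelyContinuousOnInterval.smul
    hU.absolutelyContinuousOnInterval).sub hJ.absolutelyContinuousOnInterval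
  obtain ⟨C, hC⟩ := hac.const_of_ae_hasDerivAt_zero (by
    filter_upwards [hi.ae_hasDerivAt_integral, (i1.add i2).ae_hasDerivAt_integral] with t h1 h2 ht
    have h3 := ((hφ.smooth.differentiable (by simp) t).hasDerivAt.smul
      (h1 ht 0 left_mem_uIcc)).sub (h2 ht 0 left_mem_uIcc)
    refine h3.congr_deriv ?_
    rw [add_comm (deriv φ t • U t), sub_self])
  have z : ∀ x, x ∉ Ioo 0 T → φ x = 0 := fun x hx =>
    image_eq_zero_of_notMem_tsupport fun hx' => hx (hφ.supp hx')
  have e0 := hC 0 left_mem_uIcc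
  have e1 := hC T right_mem_uIcc
  rw [← e0] at e1
  simp only [Pi.sub_apply, Pi.smul_apply', z 0 (by simp), z T (by simp), zero_smul,
    intervalIntegral.integral_same, sub_zero, zero_sub, neg_eq_zero] at e1
  rw [intervalIntegral.integral_add i1 i2, intervalIntegral.integral_of_le hT.le,
    intervalIntegral.integral_of_le hT.le, integral_Ioc_eq_integral_Ioo,
    integral_Ioc_eq_integral_Ioo] at e1
  exact eq_neg_of_add_eq_zero_left e1

/-- The continuous representative of a function in `W^{1,∞}(0,T;X)` is the primitive of its weak
derivative. -/
theorem MemW1infty.eq_integral (hT : 0 < T) {u V : ℝ → X} (h : MemW1infty T u V)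
    (hu : ContinuousOn u (Icc 0 T)) :
    ∀ t ∈ Icc 0 T, u t = u 0 + ∫ s in (0 : ℝ)..t, V s := by
  obtain ⟨K, hK⟩ := h.mem_deriv.exists_bound
  have hi := h.mem_deriv.intervalIntegrable hT.le
  have hU := (lipschitzOnWith_primitive hT.le hi hK).continuousOn
  obtain ⟨C, hC⟩ := exists_eq_const_of_integral_deriv_smul_eq_zero hT (hu.sub hU) (by
    intro φ hφ
    have hφc' := hφ.deriv'.smooth.continuous.continuousOn (s := Icc 0 T)
    simp only [Pi.sub_apply, smul_sub]
    rw [integral_sub, h.weak_deriv φ hφ, integral_deriv_smul_primitive hT h.mem_deriv hφ, sub_self]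
    · exact (hφc'.smul hu).integrableOn_Icc.mono_set Ioo_subset_Icc_self
    · exact (hφc'.smul hU).integrableOn_Icc.mono_set Ioo_subset_Icc_self)
  intro t ht
  have e0 := hC 0 (left_mem_Icc.2 hT.le)
  have e1 := hC t ht
  rw [← e0] at e1
  simp only [Pi.sub_apply, intervalIntegral.integral_same, sub_zero] at e1
  exact sub_eq_iff_eq_add.1 e1

theorem MemW1infty.exists_lipschitzOnWith (hT : 0 < T) {u V : ℝ → X} (h : MemW1infty T u V)
    (hu : ContinuousOn u (Icc 0 T)) : ∃ K, LipschitzOnWith K u (Icc 0 T) := by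
  obtain ⟨K, hK⟩ := h.mem_deriv.exists_bound
  have hU := lipschitzOnWith_primitive hT.le (h.mem_deriv.intervalIntegrable hT.le) hK
  refine ⟨K, LipschitzOnWith.of_dist_le_mul fun t ht s hs => ?_⟩
  rw [h.eq_integral hT hu t ht, h.eq_integral hT hu s hs, dist_add_left]
  exact hU.dist_le_mul t ht s hs

theorem MemW1infty.ae_hasDerivAt (hT : 0 < T) {u V : ℝ → X} (h : MemW1infty T u V)
    (hu : ContinuousOn u (Icc 0 T)) : ∀ᵐ t, t ∈ Ioo 0 T → HasDerivAt u (V t) t := by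
  filter_upwards [(h.mem_deriv.intervalIntegrable hT.le).ae_hasDerivAt_integral] with t ht htm
  have h1 := (ht (by rw [uIcc_of_le hT.le]; exact Ioo_subset_Icc_self htm) 0
    left_mem_uIcc).const_add (u 0)
  refine h1.congr_of_eventuallyEq ?_
  filter_upwards [Ioo_mem_nhds htm.1 htm.2] with s hs
  exact h.eq_integral hT hu s (Ioo_subset_Icc_self hs)

/-! ### The embedding of `H²_*` into `L^∞` and superposition operators -/

variable {a b : ℝ}

/-- The uniform norm bound by a multiple of the `L²` norm is an inequality in the Banach lattice
`L²`, and hence a closed condition. -/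
theorem isClosed_setOf_abs_le_smul_const {α : Type*} [MeasurableSpace α] (μ : Measure α)
    [IsFiniteMeasure μ] (K : ℝ) :
    IsClosed {p : Lp ℝ 2 μ × Lp ℝ 2 μ | |p.1| ≤ (K * ‖p.2‖) • Lp.const 2 μ (1 : ℝ)} := by
  have h1 : Continuous fun p : Lp ℝ 2 μ × Lp ℝ 2 μ => |p.1| :=
    continuous_fst.sup continuous_fst.neg
  have h2 : Continuous fun p : Lp ℝ 2 μ × Lp ℝ 2 μ => (K * ‖p.2‖) • Lp.const 2 μ (1 : ℝ) :=
    (continuous_const.mul continuous_snd.norm).smul continuous_const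
  exact isClosed_le h1 h2

theorem abs_le_smul_const_iff {α : Type*} [MeasurableSpace α] {μ : Measure α}
    [IsFiniteMeasure μ] {u : Lp ℝ 2 μ} {c : ℝ} :
    |u| ≤ c • Lp.const 2 μ (1 : ℝ) ↔ ∀ᵐ x ∂μ, |u x| ≤ c := by
  rw [← Lp.coeFn_le]
  refine Filter.eventually_congr ?_
  filter_upwards [Lp.coeFn_abs u, Lp.coeFn_smul c (Lp.const 2 μ (1 : ℝ)),
    Lp.coeFn_const (p := 2) (μ := μ) (1 : ℝ)] with x e1 e2 e3
  rw [e1, e2, Pi.smul_apply, e3, Function.const_apply, smul_eq_mul, mul_one]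

/-- The sup norm of a test function is controlled by its derivative: `φ(x) = ∫_a^x φ'`. -/
theorem IsTest.abs_le {φ : ℝ → ℝ} (hφ : IsTest a b φ) {p : L2 a b}
    (h2 : p =ᵐ[volume.restrict (Ioo a b)] deriv φ) {x : ℝ} (hx : x ∈ Ioo a b) :
    |φ x| ≤ √(b - a) * ‖p‖ := by
  have za : φ a = 0 := image_eq_zero_of_notMem_tsupport fun hx' => (hφ.supp hx').1.false
  have hFTC : φ x = ∫ t in Ioo a x, deriv φ t := by
    rw [← integral_Ioc_eq_integral_Ioo, ← intervalIntegral.integral_of_le hx.1.le,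
      intervalIntegral.integral_deriv_eq_sub
        (fun t _ => hφ.smooth.differentiable (by simp) t)
        (hφ.deriv'.smooth.continuous.intervalIntegrable _ _), za, sub_zero]
  have hsub : Ioo a x ⊆ Ioo a b := Ioo_subset_Ioo_right hx.2.le
  have hfin : volume.restrict (Ioo a b) (Ioo a x) ≠ ⊤ := measure_ne_top _ _
  have e5 : φ x = inner ℝ (indicatorConstLp 2 measurableSet_Ioo hfin (1 : ℝ)) p := by
    rw [L2.inner_indicatorConstLp_one, Measure.restrict_restrict measurableSet_Ioo,
      inter_eq_left.2 hsub, hFTC]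
    refine integral_congr_ae ?_
    filter_upwards [ae_restrict_of_ae_restrict_of_subset hsub h2] with t ht
    exact ht.symm
  rw [e5]
  refine (abs_real_inner_le_norm _ _).trans ?_
  gcongr
  rw [norm_indicatorConstLp (by simp) (by simp), norm_one, one_mul, Real.sqrt_eq_rpow,
    measureReal_restrict_apply measurableSet_Ioo, inter_eq_left.2 hsub,
    Real.volume_real_Ioo_of_le hx.1.le]
  simp only [ENNReal.toReal_ofNat]
  exact Real.rpow_le_rpow (by linarith [hx.1]) (by linarith [hx.2]) (by norm_num)

/-- The embedding `H¹₀(a,b) ⊆ L^∞(a,b)`. -/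
theorem ae_abs_le_of_mem_closure {u g : L2 a b} (h : (u, g) ∈ closure (testGraph a b)) :
    ∀ᵐ x ∂(volume.restrict (Ioo a b)), |u x| ≤ √(b - a) * ‖g‖ := by
  have hs : testGraph a b ⊆ {p : L2 a b × L2 a b |
      |p.1| ≤ (√(b - a) * ‖p.2‖) • Lp.const 2 (volume.restrict (Ioo a b)) (1 : ℝ)} := by
    rintro p ⟨φ, hφ, h1, h2⟩
    rw [mem_ofPred_eq, abs_le_smul_const_iff]
    filter_upwards [h1, ae_restrict_mem measurableSet_Ioo] with x hx hm
    rw [hx]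
    exact hφ.abs_le h2 hm
  have key := closure_minimal hs (isClosed_setOf_abs_le_smul_const _ _) h
  rwa [mem_ofPred_eq, abs_le_smul_const_iff] at key

/-- The quadratic Taylor estimate for a `C²` function on a bounded interval. -/
theorem exists_abs_sub_sub_le {g : ℝ → ℝ} (hg : ContDiff ℝ 2 g) (M : ℝ) :
    ∃ L : ℝ, ∀ y ∈ Icc (-M) M, ∀ z ∈ Icc (-M) M,
      |g z - g y - deriv g y * (z - y)| ≤ L * (z - y) ^ 2 := by
  have hg' : ContDiff ℝ 1 (deriv g) := ((contDiff_succ_iff_deriv (n := 1)).1 hg).2.2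
  obtain ⟨L, hL⟩ := hg'.contDiffOn.exists_lipschitzOnWith (by simp) (convex_Icc (-M) M)
    isCompact_Icc
  refine ⟨L, fun y hy z hz => ?_⟩
  have hsub : uIcc y z ⊆ Icc (-M) M := ordConnected_Icc.uIcc_subset hy hz
  have key := (convex_uIcc y z).norm_image_sub_le_of_norm_hasDerivWithin_le
    (f := fun s => g s - deriv g y * s) (f' := fun s => deriv g s - deriv g y * 1)
    (C := L * |z - y|)
    (fun s _ => (((hg.differentiable (by simp) s).hasDerivAt).sub
      ((hasDerivAt_id s).const_mul _)).hasDerivWithinAt)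
    (fun s hs => by
      rw [mul_one, ← dist_eq_norm]
      refine (hL.dist_le_mul s (hsub hs) y hy).trans ?_
      gcongr
      exact abs_sub_left_of_mem_uIcc hs)
    left_mem_uIcc right_mem_uIcc
  rw [Real.norm_eq_abs, Real.norm_eq_abs, mul_assoc, abs_mul_abs_self] at key
  convert key using 2 <;> ring

namespace H2Star

/-- The inclusion `H²_*(a,b) ⊆ L²(a,b)` as a bounded operator. -/
def toL2CLM (a b : ℝ) : H2Star a b →L[ℝ] L2 a b :=
  toL2.mkContinuous (2 * |b - a| * (2 * |b - a|)) fun u => by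
    rw [mul_assoc]
    exact norm_toL2_le u

@[simp]
theorem toL2CLM_apply (u : H2Star a b) : toL2CLM a b u = toL2 u := rfl

instance : SecondCountableTopology (H2Star a b) :=
  haveI : Fact ((2 : ENNReal) ≠ ⊤) := ⟨ENNReal.ofNat_ne_top⟩
  (AddMonoidHomClass.isometry_of_norm (dxx : H2Star a b →ₗ[ℝ] L2 a b)
    fun _ => rfl).isUniformInducing.isInducing.secondCountableTopology

/-- The embedding constant of `H²_*(a,b) ⊆ L^∞(a,b)`. -/
def supConst (a b : ℝ) : ℝ := √(b - a) * (2 * |b - a|)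

theorem supConst_nonneg (a b : ℝ) : 0 ≤ supConst a b := by
  unfold supConst
  positivity

theorem ae_abs_le (u : H2Star a b) :
    ∀ᵐ x ∂(volume.restrict (Ioo a b)), |toL2 u x| ≤ supConst a b * ‖u‖ := by
  obtain ⟨g, hc, -, hh⟩ := u.exists_spec
  filter_upwards [ae_abs_le_of_mem_closure hc] with x hx
  refine hx.trans ?_
  rw [supConst, mul_assoc]
  gcongr
  exact poincare₂ hc hh

theorem ae_mem_Icc {u : H2Star a b} {R : ℝ} (hu : ‖u‖ ≤ R) :
    ∀ᵐ x ∂(volume.restrict (Ioo a b)),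
      toL2 u x ∈ Icc (-(supConst a b * R)) (supConst a b * R) := by
  filter_upwards [u.ae_abs_le] with x hx
  exact abs_le.1 (hx.trans (mul_le_mul_of_nonneg_left hu (supConst_nonneg a b)))

theorem exists_ae_norm_comp_le {F : ℝ → ℝ} (hF : Continuous F) (R : ℝ) :
    ∃ C, 0 ≤ C ∧ ∀ u : H2Star a b, ‖u‖ ≤ R →
      ∀ᵐ x ∂(volume.restrict (Ioo a b)), ‖F (toL2 u x)‖ ≤ C := by
  obtain ⟨C, hC⟩ := isCompact_Icc.exists_bound_of_continuousOn
    (hF.continuousOn (s := Icc (-(supConst a b * R)) (supConst a b * R)))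
  refine ⟨max C 0, le_max_right _ _, fun u hu => ?_⟩
  filter_upwards [ae_mem_Icc hu] with x hx
  exact (hC _ hx).trans (le_max_left _ _)

theorem memLp_comp {F : ℝ → ℝ} (hF : Continuous F) (u : H2Star a b) (p : ENNReal) :
    MemLp (fun x => F (toL2 u x)) p (volume.restrict (Ioo a b)) := by
  obtain ⟨C, -, hC⟩ := exists_ae_norm_comp_le (a := a) (b := b) hF ‖u‖
  exact MemLp.of_bound (hF.comp_aestronglyMeasurable (Lp.aestronglyMeasurable _)) C (hC u le_rfl)

/-- The superposition operator `u ↦ F ∘ u` from `H²_*(a,b)` to `L²(a,b)`. -/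
def comp {F : ℝ → ℝ} (hF : Continuous F) (u : H2Star a b) : L2 a b :=
  (memLp_comp hF u 2).toLp

theorem inner_comp {F : ℝ → ℝ} (hF : Continuous F) (u : H2Star a b) (g : L2 a b) :
    inner ℝ (comp hF u) g = ∫ x in Ioo a b, F (toL2 u x) * g x := by
  rw [inner_eq]
  exact integral_congr_ae ((memLp_comp hF u 2).coeFn_toLp.mul Filter.EventuallyEq.rfl)

/-- Superposition operators are bounded on bounded sets. -/
theorem exists_norm_comp_le {F : ℝ → ℝ} (hF : Continuous F) (R : ℝ) :
    ∃ C, 0 ≤ C ∧ ∀ u : H2Star a b, ‖u‖ ≤ R → ‖comp hF u‖ ≤ C := by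
  obtain ⟨C, hC0, hC⟩ := exists_ae_norm_comp_le (a := a) (b := b) hF R
  refine ⟨_, ?_, fun u hu => Lp.norm_le_of_ae_bound hC0 ?_⟩
  · positivity
  · filter_upwards [hC u hu, (memLp_comp hF u 2).coeFn_toLp] with x h1 h2
    rw [comp, h2]
    exact h1

/-- The potential energy `u ↦ ∫ g(u) dx`. -/
def potential (g : ℝ → ℝ) (u : H2Star a b) : ℝ := ∫ x in Ioo a b, g (toL2 u x)

/-- The potential energy is differentiable on `H²_*(a,b)`, because its Taylor remainder is of second
order in the norm of `L²`. -/
theorem hasFDerivAt_potential {g : ℝ → ℝ} (hg : ContDiff ℝ 2 g) (u : H2Star a b) :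
    HasFDerivAt (potential g)
      ((innerSL ℝ (comp (hg.continuous_deriv (by simp)) u)).comp (toL2CLM a b)) u := by
  obtain ⟨L, hL⟩ := exists_abs_sub_sub_le hg (supConst a b * (‖u‖ + 1))
  rw [hasFDerivAt_iff_isLittleO_nhds_zero]
  refine (Asymptotics.IsBigO.trans_isLittleO ?_
    (Asymptotics.isLittleO_norm_pow_id one_lt_two)).congr_right fun _ => rfl
  refine Asymptotics.IsBigO.of_bound (|L| * ‖toL2CLM a b‖ ^ 2) ?_
  filter_upwards [Metric.ball_mem_nhds (0 : H2Star a b) one_pos] with h hh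
  rw [mem_ball_zero_iff] at hh
  have i1 := (memLp_comp hg.continuous (u + h) 1).integrable le_rfl
  have i2 := (memLp_comp hg.continuous u 1).integrable le_rfl
  have i3 : Integrable (fun x => deriv g (toL2 u x) * toL2 h x) (volume.restrict (Ioo a b)) :=
    (memLp_comp (hg.continuous_deriv (by simp)) u 2).integrable_mul (Lp.memLp (toL2 h))
  have i4 : Integrable (fun x => toL2 h x * toL2 h x) (volume.restrict (Ioo a b)) :=
    (Lp.memLp (toL2 h)).integrable_mul (Lp.memLp (toL2 h))
  have e : potential g (u + h) - potential g u -
      ((innerSL ℝ (comp (hg.continuous_deriv (by simp)) u)).comp (toL2CLM a b)) h =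
      ∫ x in Ioo a b, (g (toL2 (u + h) x) - g (toL2 u x) - deriv g (toL2 u x) * toL2 h x) := by
    have e' := integral_sub (i1.sub i2) i3
    simp only [Pi.sub_apply] at e'
    rw [e', integral_sub i1 i2]
    simp only [ContinuousLinearMap.comp_apply, innerSL_apply_apply, toL2CLM_apply, inner_comp,
      potential]
  rw [e]
  calc ‖∫ x in Ioo a b, (g (toL2 (u + h) x) - g (toL2 u x) - deriv g (toL2 u x) * toL2 h x)‖
      ≤ ∫ x in Ioo a b, |L| * (toL2 h x * toL2 h x) := by
        refine norm_integral_le_of_norm_le (i4.const_mul _) ?_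
        have hu1 : ‖u + h‖ ≤ ‖u‖ + 1 := (norm_add_le _ _).trans (by linarith)
        have hadd := Lp.coeFn_add (toL2 u) (toL2 h)
        rw [← map_add] at hadd
        filter_upwards [ae_mem_Icc (u := u) (R := ‖u‖ + 1) (by linarith), ae_mem_Icc hu1,
          hadd] with x h1 h2 h3
        have h4 := hL _ h1 _ h2
        rw [h3, Pi.add_apply, add_sub_cancel_left] at h4
        rw [h3, Pi.add_apply, Real.norm_eq_abs]
        refine h4.trans ?_
        rw [sq]
        exact mul_le_mul_of_nonneg_right (le_abs_self L) (mul_self_nonneg _)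
    _ = |L| * ‖toL2CLM a b h‖ ^ 2 := by
        rw [integral_const_mul, ← inner_eq, real_inner_self_eq_norm_sq, toL2CLM_apply]
    _ ≤ |L| * (‖toL2CLM a b‖ * ‖h‖) ^ 2 := by
        gcongr
        exact ContinuousLinearMap.le_opNorm _ _
    _ = |L| * ‖toL2CLM a b‖ ^ 2 * ‖‖h‖ ^ 2‖ := by
        rw [Real.norm_of_nonneg (by positivity)]
        ring

theorem exists_lipschitzOnWith_potential {g : ℝ → ℝ} (hg : ContDiff ℝ 2 g) (R : ℝ) :
    ∃ K, LipschitzOnWith K (potential g) (Metric.closedBall (0 : H2Star a b) R) := by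
  obtain ⟨C, hC0, hC⟩ := exists_norm_comp_le (a := a) (b := b)
    (hg.continuous_deriv (by simp : (1 : WithTop ℕ∞) ≤ 2)) R
  refine ⟨(C * ‖toL2CLM a b‖).toNNReal,
    (convex_closedBall _ _).lipschitzOnWith_of_nnnorm_hasFDerivWithin_le
      (fun u _ => (hasFDerivAt_potential hg u).hasFDerivWithinAt) fun u hu => ?_⟩
  rw [mem_closedBall_zero_iff] at hu
  rw [← norm_toNNReal]
  refine Real.toNNReal_le_toNNReal ((ContinuousLinearMap.opNorm_comp_le _ _).trans ?_)
  gcongr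
  rw [innerSL_apply_norm]
  exact hC u hu

end H2Star

/-! ### The energy identity -/

section Energy

variable {m σ : ℝ} {F₁ f₂ : ℝ → ℝ} {f : L2 a b} {u₀ : H4Star a b} {u₁ : H2Star a b} {T : ℝ}
  {u : ℝ → H2Star a b} {v : ℝ → L2 a b}

/-- The energy of a high regularity solution is absolutely continuous. -/
theorem IsHighRegularitySolution.absolutelyContinuousOnInterval_energy {F₂ : ℝ → ℝ}
    (hf₂ : ContDiff ℝ 2 f₂) (hT : 0 < T)
    (h : IsHighRegularitySolution m σ F₁ F₂ (fun _ => f) u₀ u₁ T u v) :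
    AbsolutelyContinuousOnInterval (energy m σ f₂ f u v) 0 T := by
  obtain ⟨V, hV, -⟩ := h.mem_H2
  obtain ⟨-, w, hw, -⟩ := h.mem_L2
  obtain ⟨K, hK⟩ := hV.exists_lipschitzOnWith hT h.continuousOn
  obtain ⟨N, hN⟩ := hw.exists_lipschitzOnWith hT h.continuousOn_deriv
  obtain ⟨R, hR⟩ := isCompact_Icc.exists_bound_of_continuousOn h.continuousOn
  obtain ⟨P, hP⟩ := H2Star.exists_lipschitzOnWith_potential (a := a) (b := b) hf₂ R
  have a1 := lipschitzWith_one_norm.comp_lipschitzOnWith hN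
  have a2 := lipschitzWith_one_norm.comp_lipschitzOnWith hK
  have a3 := hP.comp hK fun t ht => mem_closedBall_zero_iff.2 (hR t ht)
  have a4 := ((innerSL ℝ f).comp (H2Star.toL2CLM a b)).lipschitz.comp_lipschitzOnWith hK
  rw [← uIcc_of_le hT.le] at a1 a2 a3 a4
  have b1 := a1.absolutelyContinuousOnInterval
  have b2 := a2.absolutelyContinuousOnInterval
  have key := ((((b1.mul b1).const_mul (m / 2)).add ((b2.mul b2).const_mul (σ / 2))).add
    a3.absolutelyContinuousOnInterval).sub a4.absolutelyContinuousOnInterval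
  refine (congrArg (AbsolutelyContinuousOnInterval · 0 T) (funext fun t => ?_)).mpr key
  simp [energy, H2Star.potential, sq]

/-- For almost every time the weak form of the equation holds with all test functions at once,
since `H²_*` is separable. -/
theorem IsHighRegularitySolution.exists_ae_forall_eq {F₂ : ℝ → ℝ} (hF₁ : Continuous F₁)
    (hF₂ : Continuous F₂) (hT : 0 < T)
    (h : IsHighRegularitySolution m σ F₁ F₂ (fun _ => f) u₀ u₁ T u v) :
    ∃ (V : ℝ → H2Star a b) (w : ℝ → L2 a b), ∀ᵐ t, t ∈ Ioo 0 T →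
      HasDerivAt u (V t) t ∧ HasDerivAt v (w t) t ∧ v t = H2Star.toL2 (V t) ∧
      ∀ ψ : H2Star a b, m * inner ℝ (w t) (H2Star.toL2 ψ)
        + inner ℝ (H2Star.comp hF₁ (V t)) (H2Star.toL2 ψ) + σ * inner ℝ (u t) ψ
        + inner ℝ (H2Star.comp hF₂ (u t)) (H2Star.toL2 ψ) = inner ℝ f (H2Star.toL2 ψ) := by
  obtain ⟨V, hV, hvV⟩ := h.mem_H2
  obtain ⟨-, w, hw, heq⟩ := h.mem_L2
  have hall := ae_all_iff.2 fun n => heq (TopologicalSpace.denseSeq (H2Star a b) n)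
  rw [ae_restrict_iff' measurableSet_Ioo] at hall hvV
  refine ⟨V, w, ?_⟩
  filter_upwards [hall, hvV, hV.ae_hasDerivAt hT h.continuousOn,
    hw.ae_hasDerivAt hT h.continuousOn_deriv] with t h1 h2 h3 h4 ht
  refine ⟨h3 ht, h4 ht, h2 ht, fun ψ => ?_⟩
  have hc : Continuous fun ψ : H2Star a b => H2Star.toL2 ψ := (H2Star.toL2CLM a b).continuous
  refine congrFun (Continuous.ext_on (TopologicalSpace.denseRange_denseSeq (H2Star a b))
    (f := fun ψ : H2Star a b => m * inner ℝ (w t) (H2Star.toL2 ψ)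
        + inner ℝ (H2Star.comp hF₁ (V t)) (H2Star.toL2 ψ) + σ * inner ℝ (u t) ψ
        + inner ℝ (H2Star.comp hF₂ (u t)) (H2Star.toL2 ψ))
    (g := fun ψ => inner ℝ f (H2Star.toL2 ψ)) (by fun_prop) (by fun_prop) ?_) ψ
  rintro _ ⟨n, rfl⟩
  have h5 := h1 ht n
  simp only [h2 ht] at h5
  simp only [H2Star.inner_comp]
  exact h5

/-- The pointwise energy identity `E_u' = -(F₁(u'), u')`: the weak form of the equation may be
tested with `u'(t) ∈ H²_*`. -/
theorem IsHighRegularitySolution.ae_hasDerivAt_energy (hF₁ : Continuous F₁)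
    (hf₂ : ContDiff ℝ 2 f₂) (hT : 0 < T)
    (h : IsHighRegularitySolution m σ F₁ (deriv f₂) (fun _ => f) u₀ u₁ T u v) :
    ∀ᵐ t, t ∈ Ioo 0 T → HasDerivAt (energy m σ f₂ f u v) (-dissipation F₁ v t) t := by
  obtain ⟨V, w, hVw⟩ := h.exists_ae_forall_eq hF₁ (hf₂.continuous_deriv (by simp)) hT
  filter_upwards [hVw] with t ht htm
  obtain ⟨hu, hv, hvV, heq⟩ := ht htm
  have d1 := (hv.norm_sq.const_mul (m / 2)).add (hu.norm_sq.const_mul (σ / 2))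
  have d2 := (H2Star.hasFDerivAt_potential hf₂ (u t)).comp_hasDerivAt t hu
  have d3 := ((innerSL ℝ f).comp (H2Star.toL2CLM a b)).hasFDerivAt.comp_hasDerivAt t hu
  have d4 := (d1.add d2).sub d3
  refine d4.congr_deriv ?_
  have e := heq (V t)
  have ed : dissipation F₁ v t = inner ℝ (H2Star.comp hF₁ (V t)) (H2Star.toL2 (V t)) := by
    rw [H2Star.inner_comp, dissipation, hvV]
  rw [ed, hvV, real_inner_comm (w t)]
  simp only [ContinuousLinearMap.comp_apply, innerSL_apply_apply, H2Star.toL2CLM_apply]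
  linarith

theorem dissipation_nonneg (hF₁mono : Monotone F₁) (hF₁0 : F₁ 0 = 0) (v : ℝ → L2 a b) (t : ℝ) :
    0 ≤ dissipation F₁ v t := by
  refine integral_nonneg fun x => ?_
  rcases le_total 0 (v t x) with h | h
  · exact mul_nonneg (hF₁0 ▸ hF₁mono h) h
  · exact mul_nonneg_of_nonpos_of_nonpos (hF₁0 ▸ hF₁mono h) h

/-- The energy identity in integrated form. -/
theorem IsHighRegularitySolution.energy_sub_energy (hF₁ : Continuous F₁)
    (hf₂ : ContDiff ℝ 2 f₂) (hT : 0 < T)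
    (h : IsHighRegularitySolution m σ F₁ (deriv f₂) (fun _ => f) u₀ u₁ T u v) :
    IntegrableOn (dissipation F₁ v) (Ioc 0 T) ∧ ∀ s ∈ Icc 0 T, ∀ t ∈ Icc s T,
      energy m σ f₂ f u v s - energy m σ f₂ f u v t = ∫ r in Ioc s t, dissipation F₁ v r := by
  have hac := h.absolutelyContinuousOnInterval_energy hf₂ hT
  have hd : ∀ᵐ t, t ∈ Ioc 0 T → deriv (energy m σ f₂ f u v) t = -dissipation F₁ v t := by
    have hT' : ∀ᵐ t : ℝ, t ≠ T := by simp [ae_iff]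
    filter_upwards [h.ae_hasDerivAt_energy hF₁ hf₂ hT, hT'] with t ht htT htm
    exact (ht ⟨htm.1, lt_of_le_of_ne htm.2 htT⟩).deriv
  constructor
  · have hi := hac.intervalIntegrable_deriv
    rw [intervalIntegrable_iff_integrableOn_Ioc_of_le hT.le] at hi
    refine hi.neg.congr_fun_ae ?_
    rw [Filter.EventuallyEq, ae_restrict_iff' measurableSet_Ioc]
    filter_upwards [hd] with t ht htm
    rw [Pi.neg_apply, ht htm, neg_neg]
  · intro s hs t ht
    have hsub : uIcc s t ⊆ uIcc 0 T := by
      rw [uIcc_of_le ht.1, uIcc_of_le hT.le]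
      exact Icc_subset_Icc hs.1 ht.2
    have key := (hac.mono hsub).integral_deriv_eq_sub
    rw [intervalIntegral.integral_of_le ht.1] at key
    rw [← neg_sub, ← key, ← integral_neg]
    refine setIntegral_congr_ae measurableSet_Ioc ?_
    filter_upwards [hd] with r hr hrm
    rw [hr ⟨hs.1.trans_lt hrm.1, hrm.2.trans ht.2⟩, neg_neg]

/-- The energy controls the norm of `H²_*`, because the potential is bounded below and the load term
is absorbed with Young's inequality. -/
theorem exists_le_energy (hm : 0 < m) (hσ : 0 < σ) (hf₂ : ContDiff ℝ 2 f₂)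
    (hf₂bdd : ∃ c : ℝ, ∀ y, c ≤ f₂ y) (f : L2 a b) :
    ∃ C : ℝ, ∀ (u : ℝ → H2Star a b) (v : ℝ → L2 a b) (t : ℝ),
      σ / 4 * ‖u t‖ ^ 2 - C ≤ energy m σ f₂ f u v t := by
  obtain ⟨c, hc⟩ := hf₂bdd
  set k := ‖f‖ * ‖H2Star.toL2CLM a b‖
  refine ⟨k ^ 2 / σ - c * (volume.restrict (Ioo a b)).real univ, fun u v t => ?_⟩
  have h1 : c * (volume.restrict (Ioo a b)).real univ
      ≤ ∫ x in Ioo a b, f₂ (H2Star.toL2 (u t) x) := by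
    have := integral_mono (integrable_const c)
      ((H2Star.memLp_comp hf₂.continuous (u t) 1).integrable le_rfl) fun x => hc _
    rwa [integral_const, smul_eq_mul, mul_comm] at this
  have h2 : inner ℝ f (H2Star.toL2 (u t)) ≤ k * ‖u t‖ :=
    calc inner ℝ f (H2Star.toL2 (u t)) ≤ ‖f‖ * ‖H2Star.toL2CLM a b (u t)‖ := real_inner_le_norm _ _
      _ ≤ ‖f‖ * (‖H2Star.toL2CLM a b‖ * ‖u t‖) := by
        gcongr
        exact ContinuousLinearMap.le_opNorm _ _
      _ = k * ‖u t‖ := by rw [mul_assoc]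
  have h3 : k * ‖u t‖ ≤ σ / 4 * ‖u t‖ ^ 2 + k ^ 2 / σ := by
    have : σ / 4 * ‖u t‖ ^ 2 + k ^ 2 / σ - k * ‖u t‖ = (σ * ‖u t‖ - 2 * k) ^ 2 / (4 * σ) := by
      field_simp
      ring
    have h4 : 0 ≤ (σ * ‖u t‖ - 2 * k) ^ 2 / (4 * σ) := by positivity
    linarith
  have h4 : 0 ≤ m / 2 * ‖v t‖ ^ 2 := by positivity
  unfold energy
  linarith

end Energy

end Beam

end

theorem mainTheorem2 (a b : ℝ) (hab : a < b) (m σ : ℝ) (hm : 0 < m) (hσ : 0 < σ)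
    (F₁ : ℝ → ℝ) (hF₁ : ContDiff ℝ 1 F₁) (hF₁mono : Monotone F₁) (hF₁0 : F₁ 0 = 0)
    (f₂ : ℝ → ℝ) (hf₂ : ContDiff ℝ 2 f₂) (hf₂bdd : ∃ c : ℝ, ∀ y, c ≤ f₂ y)
    (f : Beam.L2 a b) (u₀ : Beam.H4Star a b) (u₁ : Beam.H2Star a b) :
    -- solutions on a finite time interval, with bounds that do not depend on its length
    (∃ C : ℝ, ∀ T : ℝ, 0 < T → ∀ (u : ℝ → Beam.H2Star a b) (v : ℝ → Beam.L2 a b),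
      Beam.IsHighRegularitySolution m σ F₁ (deriv f₂) (fun _ => f) u₀ u₁ T u v →
        AntitoneOn (Beam.energy m σ f₂ f u v) (Icc 0 T) ∧
        (∀ t ∈ Icc 0 T, ‖u t‖ ≤ C) ∧
        IntegrableOn (Beam.dissipation F₁ v) (Ioc 0 T) ∧
        ∫ t in Ioc 0 T, Beam.dissipation F₁ v t ≤ C) ∧
    -- the solution on `[0,∞)`
    (∀ (u : ℝ → Beam.H2Star a b) (v : ℝ → Beam.L2 a b),
      (∀ T : ℝ, 0 < T →
        Beam.IsHighRegularitySolution m σ F₁ (deriv f₂) (fun _ => f) u₀ u₁ T u v) →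
        AntitoneOn (Beam.energy m σ f₂ f u v) (Ici 0) ∧
        (∃ C : ℝ, ∀ t : ℝ, 0 ≤ t → ‖u t‖ ≤ C) ∧
        IntegrableOn (Beam.dissipation F₁ v) (Ioi 0)) := by
  have hnn := Beam.dissipation_nonneg (a := a) (b := b) hF₁mono hF₁0
  obtain ⟨C₀, hC₀⟩ := Beam.exists_le_energy (a := a) (b := b) hm hσ hf₂ hf₂bdd f
  -- the initial energy, which depends on the data only
  set E₀ : ℝ := Beam.energy m σ f₂ f (fun _ => Beam.H4Star.toH2 u₀)
    (fun _ => Beam.H2Star.toL2 u₁) 0 with hE₀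
  obtain ⟨C, hC⟩ : ∃ C : ℝ, ∀ T : ℝ, 0 < T → ∀ (u : ℝ → Beam.H2Star a b) (v : ℝ → Beam.L2 a b),
      Beam.IsHighRegularitySolution m σ F₁ (deriv f₂) (fun _ => f) u₀ u₁ T u v →
        AntitoneOn (Beam.energy m σ f₂ f u v) (Icc 0 T) ∧
        (∀ t ∈ Icc 0 T, ‖u t‖ ≤ C) ∧
        IntegrableOn (Beam.dissipation F₁ v) (Ioc 0 T) ∧
        ∫ t in Ioc 0 T, Beam.dissipation F₁ v t ≤ C := by
    refine ⟨max √(4 / σ * (E₀ + C₀)) (E₀ + C₀), fun T hT u v h => ?_⟩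
    obtain ⟨hint, hid⟩ := h.energy_sub_energy hF₁.continuous hf₂ hT
    have hanti : AntitoneOn (Beam.energy m σ f₂ f u v) (Icc 0 T) := fun s hs t ht hst => by
      have h1 := hid s hs t ⟨hst, ht.2⟩
      have h2 : 0 ≤ ∫ r in Ioc s t, Beam.dissipation F₁ v r := integral_nonneg (hnn v)
      linarith
    have h0 : Beam.energy m σ f₂ f u v 0 = E₀ := by
      rw [hE₀]
      simp only [Beam.energy, h.init, h.init_deriv]
    refine ⟨hanti, fun t ht => le_max_of_le_left (Real.le_sqrt_of_sq_le ?_), hint,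
      le_max_of_le_right ?_⟩
    · have h1 := hC₀ u v t
      have h2 := hanti (left_mem_Icc.2 hT.le) ht ht.1
      rw [h0] at h2
      have h3 : σ / 4 * ‖u t‖ ^ 2 ≤ E₀ + C₀ := by linarith
      calc ‖u t‖ ^ 2 = 4 / σ * (σ / 4 * ‖u t‖ ^ 2) := by field_simp
        _ ≤ 4 / σ * (E₀ + C₀) := by gcongr
    · have h1 := hC₀ u v T
      have h2 : 0 ≤ σ / 4 * ‖u T‖ ^ 2 := by positivity
      rw [← hid 0 (left_mem_Icc.2 hT.le) T (right_mem_Icc.2 hT.le), h0]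
      linarith
  refine ⟨⟨C, hC⟩, fun u v h => ⟨fun s hs t ht hst => ?_, ⟨C, fun t ht => ?_⟩, ?_⟩⟩
  · have ht' : (0 : ℝ) < t + 1 := by linarith [mem_Ici.1 ht]
    exact (hC _ ht' u v (h _ ht')).1 ⟨hs, by linarith⟩ ⟨ht, by linarith⟩ hst
  · exact (hC (t + 1) (by linarith) u v (h _ (by linarith))).2.1 t ⟨ht, by linarith⟩
  · have hpos : ∀ n : ℕ, (0 : ℝ) < n + 1 := fun n => by positivity
    refine integrableOn_Ioi_of_intervalIntegral_norm_bounded (l := Filter.atTop)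
      (b := fun n : ℕ => (n : ℝ) + 1) C 0 (fun n => (hC _ (hpos n) u v (h _ (hpos n))).2.2.1)
      (Filter.tendsto_atTop_add_const_right _ _ tendsto_natCast_atTop_atTop)
      (Filter.Eventually.of_forall fun n => ?_)
    rw [intervalIntegral.integral_of_le (hpos n).le]
    simp only [Real.norm_of_nonneg (hnn v _)]
    exact (hC _ (hpos n) u v (h _ (hpos n))).2.2.2
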